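/- Let $G=SL(n+1,\mathbb R)$, let $e_0,\dots,e_n$ be the standard basis of $\mathbb R^{n+1}$, and let $P\subset G$ be the stabiliser of the ray $\mathbb R_{>0}e_0$; write $b_{00}>0$ for the number with $b e_0=b_{00}e_0$, $b\in P$. Identify $x\in\mathbb R^n$ with the matrix $\left(\begin{smallmatrix}0&0\\x&0\end{smallmatrix}\right)\in\mathfrak g_{-1}\subset\mathfrak{sl}(n+1,\mathbb R)$. Let $(p:\mathcal G\to M,\omega)$ be a smooth Cartan geometry of type $(G,P)$, for instance the one canonically associated with an oriented projective structure on an $n$-manifold $M$. Its standard tractor bundle is $\mathcal TM=\mathcal G\times_P\mathbb R^{n+1}$ with the tractor connection induced by $\omega$; the density bundle $\mathcal E(-1)\subset\mathcal TM$ is induced by $\mathbb R e_0\subset\mathbb R^{n+1}$, and $\mathcal E(1)=\mathcal E(-1)^*$. Sections over $U\subset M$ of the bundle associated with a $P$-representation $\mathbb W$ are identified with functions $f:p^{-1}(U)\to\mathbb W$ such that $f(u\cdot b)=b^{-1}\cdot f(u)$; for $\mathcal E(1)$ this reads $f(u\cdot b)=b_{00}f(u)$. Fix $u_0\in\mathcal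 G$ and a normal chart determined by $u_0$: there are an open neighbourhood $V$ of $0$ in $\mathfrak g_{-1}=\mathbb R^n$ and a smooth map $\Phi:V\to\mathcal G$, where $\Phi(x)$ is the value at time $1$ of the flow line through $u_0$ of the vector field $\omega^{-1}(x)$, such that $\phi=p\circ\Phi$ is a diffeomorphism from $V$ onto an open set $U\subset M$. The components $x_1,\dots,x_n$ of $\phi^{-1}$ are the normal coordinates on $U$, and $\sigma=\Phi\circ\phi^{-1}:U\to\mathcal G$ is the normal section. Let $X^0$ be the normal frame of $\mathcal E(1)$ over $U$, i.e. the section with $X^0(\sigma(y)\cdot b)=b_{00}$ (the dual of the section of $\mathcal E(-1)$ determined by $e_0$ and $\sigma$), and put $X^i=x_iX^0$ for $i=1,\dots,n$. The homogeneous model is $G\to G/P$, where $G/P$ is the sphere of rays in $\mathbb R^{n+1}$ via $gP\mapsto\mathbb R_{>0}\,ge_0$; functions on $\mathbb R^{n+1}\setminus\{0\}$ that are positively homogeneous of degree one are the sections of $\mathcal E(1)$ over $G/P$, the function $h$ corresponding to $g\mapsto h(ge_0)$ on $G$. The normal comparison map is $\psi:U\to G/P$, $\psi(\phi(x))=\exp(x)P$.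 It is covered by the bundle map $\Psi:p^{-1}(U)\to G$, $\Psi(\sigma(\phi(x))\cdot b)=\exp(x)b$. The (local) generalised homogeneous coordinates on $U$ are the pullbacks along $\psi$ (that is, by $\Psi$) of the $n+1$ standard coordinates on $\mathbb R^{n+1}\setminus\{0\}$. Then the densities $X^0,\dots,X^n$ are smooth sections of $\mathcal E(1)$ over $U$, and they are exactly the generalised homogeneous coordinates. Moreover: (i) for every $u\in p^{-1}(U)$ the vector $(X^0(u),\dots,X^n(u))$ is non-zero and spans the ray $\psi(p(u))$; (ii) let $t_0,\dots,t_n$ be the sections of $\mathcal TM$ over $U$ obtained from the frame $[u_0,e_0],\dots,[u_0,e_n]$ of $\mathcal T_{p(u_0)}M$ by parallel transport, for the tractor connection, along the curves $p(c(s))$, $0\le s\le 1$, where $c$ is the flow line through $u_0$ of $\omega^{-1}(x)$, $x\in V$. These sections exist and are uniquely determined, they form a frame of $\mathcal TM$ over $U$, and $(X^0,\dots,X^n)$ is the unique tuple of sections of $\mathcal E(1)$ for which $\sum_iX^i\otimes t_i$ is the canonical section of $\mathcal E(1)\otimes\mathcal TM$ given by the inclusion $\mathcal E(-1)\subset\mathcal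 TM$. -/

import Mathlib

open scoped Manifold ContDiff Matrix Topology

namespace ProjTractor

/-- The first vector `e₀` of the standard basis of `ℝ^{n+1}`. -/
def e0 (n : ℕ) : Fin (n + 1) → ℝ := Pi.single 0 1

/-- `SL(n+1, ℝ)`. -/
abbrev SL (n : ℕ) := Matrix.SpecialLinearGroup (Fin (n + 1)) ℝ

/-- The stabiliser `P` in `SL(n+1, ℝ)` of the ray spanned by `e₀`. -/
def P (n : ℕ) : Subgroup (SL n) where
  carrier := {g | ∃ a : ℝ, 0 < a ∧ g.1 *ᵥ e0 n = a • e0 n}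
  one_mem' := ⟨1, one_pos, by simp⟩
  mul_mem' := by
    rintro g h ⟨a, ha, hg⟩ ⟨b, hb, hh⟩
    refine ⟨b * a, mul_pos hb ha, ?_⟩
    rw [Matrix.SpecialLinearGroup.coe_mul, ← Matrix.mulVec_mulVec, hh, Matrix.mulVec_smul, hg,
      smul_smul]
  inv_mem' := by
    rintro g ⟨a, ha, hg⟩
    refine ⟨a⁻¹, inv_pos.2 ha, ?_⟩
    have h1 : (g⁻¹ : SL n).1 *ᵥ (g.1 *ᵥ e0 n) = e0 n := by
      rw [Matrix.mulVec_mulVec, ← Matrix.SpecialLinearGroup.coe_mul]; simp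
    rw [hg, Matrix.mulVec_smul] at h1
    have h2 := congrArg (fun v => a⁻¹ • v) h1
    simpa [smul_smul, ha.ne'] using h2

/-- The underlying matrix of an element of `P`. -/
def mat {n : ℕ} (b : P n) : Matrix (Fin (n + 1)) (Fin (n + 1)) ℝ := b.1.1

theorem mat_mul {n : ℕ} (a b : P n) : mat (a * b) = mat a * mat b := rfl

theorem mat_one {n : ℕ} : mat (1 : P n) = 1 := rfl

theorem mat_mulVec_e0 {n : ℕ} (b : P n) : mat b *ᵥ e0 n = mat b 0 0 • e0 n := by
  obtain ⟨a, -, h⟩ := b.2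
  have h' : mat b *ᵥ e0 n = a • e0 n := h
  have h0 := congrFun h' 0
  simp only [e0, Matrix.mulVec_single_one, Matrix.col_apply, Pi.smul_apply, Pi.single_eq_same,
    smul_eq_mul, mul_one] at h0
  rw [h0, h']

theorem mat_succ_zero {n : ℕ} (b : P n) (i : Fin n) : mat b i.succ 0 = 0 := by
  have h := congrFun (mat_mulVec_e0 b) i.succ
  simpa [e0] using h

theorem mat_zero_zero_pos {n : ℕ} (b : P n) : 0 < mat b 0 0 := by
  obtain ⟨a, ha, h⟩ := b.2
  have h0 := congrFun (show mat b *ᵥ e0 n = a • e0 n from h) 0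
  simp only [e0, Matrix.mulVec_single_one, Matrix.col_apply, Pi.smul_apply, Pi.single_eq_same,
    smul_eq_mul, mul_one] at h0
  rwa [h0]

/-! ### The Lie group structure of `P`

An element of `P` is a block matrix `(a, Z; 0, B)` with `a * det B = 1`, `a > 0`; it is determined
by `(Z, B)`, and `(Z, B)` identifies `P` with the open subset `{det B > 0}` of a vector space. -/

/-- The vector space of pairs `(Z, B)`. -/
abbrev PModel (n : ℕ) := (Fin n → ℝ) × (Fin n → Fin n → ℝ)

/-- The global coordinates `b ↦ (Z, B)` on `P`. -/
def pChart {n : ℕ} (b : P n) : PModel n :=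
  (fun j => mat b 0 j.succ, fun i j => mat b i.succ j.succ)

theorem det_of_col {n : ℕ} (A : Matrix (Fin (n + 1)) (Fin (n + 1)) ℝ)
    (h : ∀ i : Fin n, A i.succ 0 = 0) :
    A.det = A 0 0 * (Matrix.of fun i j : Fin n => A i.succ j.succ).det := by
  rw [Matrix.det_succ_column_zero, Fin.sum_univ_succ]
  simp only [h]
  simp
  left
  rfl

/-- The block matrix `(1 / det B, Z; 0, B)`. -/
noncomputable def pMatrix {n : ℕ} (q : PModel n) : Matrix (Fin (n + 1)) (Fin (n + 1)) ℝ :=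
  Matrix.of (Fin.cons (Fin.cons (Matrix.of q.2).det⁻¹ q.1) fun i => Fin.cons 0 (q.2 i))

theorem mat_eq {n : ℕ} (b : P n) : mat b = pMatrix (pChart b) := by
  have hd : mat b 0 0 * (Matrix.of fun i j : Fin n => mat b i.succ j.succ).det = 1 := by
    rw [← det_of_col _ (mat_succ_zero b)]; exact b.1.2
  ext i j
  refine Fin.cases ?_ (fun i => ?_) i <;> refine Fin.cases ?_ (fun j => ?_) j
  · simpa [pMatrix, pChart] using eq_inv_of_mul_eq_one_left hd
  · simp [pMatrix, pChart]
  · simpa [pMatrix, pChart] using mat_succ_zero b i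
  · simp [pMatrix, pChart]

theorem det_pChart_pos {n : ℕ} (b : P n) : 0 < (Matrix.of (pChart b).2).det := by
  have hd : mat b 0 0 * (Matrix.of fun i j : Fin n => mat b i.succ j.succ).det = 1 := by
    rw [← det_of_col _ (mat_succ_zero b)]; exact b.1.2
  have h0 := mat_zero_zero_pos b
  by_contra hneg
  have := mul_nonpos_of_nonneg_of_nonpos h0.le (not_lt.1 hneg)
  simp only [pChart] at this
  linarith

theorem range_pChart (n : ℕ) :
    Set.range (pChart (n := n)) = {q : PModel n | 0 < (Matrix.of q.2).det} := by
  ext q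
  constructor
  · rintro ⟨b, rfl⟩
    exact det_pChart_pos b
  · intro hq
    have hq' : (Matrix.of q.2).det ≠ 0 := ne_of_gt hq
    refine ⟨⟨⟨pMatrix q, ?_⟩, ⟨(Matrix.of q.2).det⁻¹, inv_pos.2 hq, ?_⟩⟩, ?_⟩
    · rw [det_of_col _ (by simp [pMatrix])]
      have : (Matrix.of fun i j : Fin n => pMatrix q i.succ j.succ) = Matrix.of q.2 := by
        ext i j; simp [pMatrix]
      rw [this]
      simp [pMatrix, hq']
    · ext i
      refine Fin.cases ?_ (fun i => ?_) i <;> simp [e0, pMatrix]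
    · ext i <;> simp [pChart, mat, pMatrix]

theorem continuous_mat (n : ℕ) : Continuous (mat (n := n)) :=
  continuous_subtype_val.comp continuous_subtype_val

theorem isOpenEmbedding_pChart (n : ℕ) : Topology.IsOpenEmbedding (pChart (n := n)) := by
  have hc : Continuous (pChart (n := n)) := by
    refine Continuous.prodMk ?_ ?_
    · exact continuous_pi fun j => (continuous_mat n).matrix_elem _ _
    · exact continuous_pi fun i => continuous_pi fun j => (continuous_mat n).matrix_elem _ _
  have hdet : Continuous fun q : PModel n => (Matrix.of q.2).det :=
    Continuous.matrix_det continuous_snd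
  refine ⟨⟨⟨?_⟩, ?_⟩, ?_⟩
  · refine le_antisymm hc.le_induced ?_
    have hmat : Topology.IsInducing (mat (n := n)) :=
      Topology.IsInducing.subtypeVal.comp Topology.IsInducing.subtypeVal
    rw [hmat.eq_induced, ← continuous_iff_le_induced]
    let _ : TopologicalSpace (P n) := TopologicalSpace.induced pChart inferInstance
    have hc' : Continuous (pChart (n := n)) := continuous_induced_dom
    refine continuous_matrix fun i j => ?_
    simp only [mat_eq]
    refine Fin.cases ?_ (fun i => ?_) i <;> refine Fin.cases ?_ (fun j => ?_) j
    · exact (hdet.comp hc').inv₀ fun b => (det_pChart_pos b).ne'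
    · exact (continuous_apply j).comp (continuous_fst.comp hc')
    · exact continuous_const
    · exact
        (continuous_apply j).comp ((continuous_apply i).comp (continuous_snd.comp hc'))
  · intro a b h
    apply Subtype.ext
    apply Subtype.ext
    change mat a = mat b
    rw [mat_eq, mat_eq, h]
  · rw [range_pChart]
    exact isOpen_lt continuous_const hdet

noncomputable instance (n : ℕ) : ChartedSpace (PModel n) (P n) :=
  (isOpenEmbedding_pChart n).singletonChartedSpace

instance (n : ℕ) : IsManifold 𝓘(ℝ, PModel n) ∞ (P n) :=
  (isOpenEmbedding_pChart n).isManifold_singleton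

/-! ### Cartan geometries of type `(SL(n+1, ℝ), P)` -/

/-- The Lie algebra `sl(n+1, ℝ)`. -/
abbrev sl (n : ℕ) := LieAlgebra.SpecialLinear.sl (Fin (n + 1)) ℝ

/-- A Cartan geometry `(p : 𝒢 → M, ω)` of type `(SL(n+1, ℝ), P)`. -/
structure CartanGeometry (n : ℕ) (M : Type*) [TopologicalSpace M]
    [ChartedSpace (EuclideanSpace ℝ (Fin n)) M]
    {E : Type*} [NormedAddCommGroup E] [NormedSpace ℝ E]
    (𝒢 : Type*) [TopologicalSpace 𝒢] [ChartedSpace E 𝒢] [IsManifold 𝓘(ℝ, E) ∞ 𝒢] where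
  /-- the bundle projection `p` -/
  proj : 𝒢 → M
  proj_smooth : ContMDiff 𝓘(ℝ, E) (𝓡 n) ∞ proj
  /-- the principal right action -/
  act : 𝒢 → P n → 𝒢
  act_one : ∀ u, act u 1 = u
  act_mul : ∀ u a b, act u (a * b) = act (act u a) b
  act_smooth : ContMDiff (𝓘(ℝ, E).prod 𝓘(ℝ, PModel n)) 𝓘(ℝ, E) ∞
    fun q : 𝒢 × P n => act q.1 q.2
  proj_act : ∀ u b, proj (act u b) = proj u
  locally_trivial : ∀ x : M, ∃ (U : Set M) (e : OpenPartialHomeomorph 𝒢 (M × P n)),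
    IsOpen U ∧ x ∈ U ∧ e.source = proj ⁻¹' U ∧ e.target = U ×ˢ Set.univ ∧
    ContMDiffOn 𝓘(ℝ, E) ((𝓡 n).prod 𝓘(ℝ, PModel n)) ∞ e e.source ∧
    ContMDiffOn ((𝓡 n).prod 𝓘(ℝ, PModel n)) 𝓘(ℝ, E) ∞ e.symm e.target ∧
    ∀ u ∈ e.source, (e u).1 = proj u ∧ ∀ b, (e (act u b)).2 = (e u).2 * b
  /-- the Cartan connection `ω` -/
  form : ∀ u : 𝒢, TangentSpace 𝓘(ℝ, E) u ≃ₗ[ℝ] sl n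
  form_smooth : ∀ i j, ContMDiff 𝓘(ℝ, E).tangent 𝓘(ℝ, ℝ) ∞
    fun v : TangentBundle 𝓘(ℝ, E) 𝒢 => (form v.1 v.2).1 i j
  form_equivariant : ∀ (u : 𝒢) (b : P n) (ξ : TangentSpace 𝓘(ℝ, E) u),
    (form (act u b) (mfderiv 𝓘(ℝ, E) 𝓘(ℝ, E) (fun v => act v b) u ξ)).1 =
      mat b⁻¹ * (form u ξ).1 * mat b
  /-- `ω` reproduces the generators of fundamental vector fields: for `A ∈ T₁P`, the fundamental
  field at `u` is the image of `A` under the tangent map of `b ↦ u · b`; the right-hand side is `A`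
  regarded as a matrix. -/
  form_fundamental : ∀ (u : 𝒢) (A : TangentSpace 𝓘(ℝ, PModel n) (1 : P n)) (i j : Fin (n + 1)),
    (form (act u 1) (mfderiv 𝓘(ℝ, PModel n) 𝓘(ℝ, E) (fun b => act u b) 1 A)).1 i j =
      mfderiv 𝓘(ℝ, PModel n) 𝓘(ℝ, ℝ) (fun b : P n => mat b i j) 1 A

/-- The element of `𝔤₋₁` with components `x`. -/
def gMinusMatrix {n : ℕ} (x : EuclideanSpace ℝ (Fin n)) :
    Matrix (Fin (n + 1)) (Fin (n + 1)) ℝ :=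
  Matrix.of (Fin.cons 0 fun i => Fin.cons (x i) 0)

/-- The identification of `ℝⁿ` with `𝔤₋₁ ⊂ sl(n+1, ℝ)`. -/
def gMinus {n : ℕ} (x : EuclideanSpace ℝ (Fin n)) : sl n :=
  ⟨gMinusMatrix x, by
    change Matrix.trace (gMinusMatrix x) = 0
    simp [Matrix.trace, Fin.sum_univ_succ, gMinusMatrix]⟩

theorem gMinusMatrix_sq {n : ℕ} (x : EuclideanSpace ℝ (Fin n)) :
    gMinusMatrix x * gMinusMatrix x = 0 := by
  ext i j
  rw [Matrix.mul_apply, Fin.sum_univ_succ]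
  refine Fin.cases ?_ (fun i => ?_) i <;> simp [gMinusMatrix]

theorem exp_gMinusMatrix {n : ℕ} (x : EuclideanSpace ℝ (Fin n)) :
    NormedSpace.exp (gMinusMatrix x) = 1 + gMinusMatrix x := by
  rw [NormedSpace.exp_eq_tsum ℝ]
  dsimp only
  rw [tsum_eq_sum (s := Finset.range 2)]
  · simp [Finset.sum_range_succ]
  · intro k hk
    obtain ⟨m, rfl⟩ : ∃ m, k = 2 + m := ⟨k - 2, by simp at hk; omega⟩
    rw [pow_add, pow_two, gMinusMatrix_sq]
    simp

theorem det_exp_gMinusMatrix {n : ℕ} (x : EuclideanSpace ℝ (Fin n)) :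
    (NormedSpace.exp (gMinusMatrix x)).det = 1 := by
  rw [exp_gMinusMatrix, Matrix.det_of_isLowerTriangular]
  · refine Finset.prod_eq_one fun i _ => ?_
    refine Fin.cases ?_ (fun i => ?_) i <;> simp [gMinusMatrix]
  · intro i j hij
    have hij : i < j := hij
    rw [Matrix.add_apply, Matrix.one_apply_ne hij.ne]
    revert hij
    refine Fin.cases ?_ (fun i => ?_) i <;> refine Fin.cases ?_ (fun j => ?_) j <;>
      simp [gMinusMatrix]

/-- `exp X ∈ SL(n+1, ℝ)` for `X ∈ 𝔤₋₁`. -/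
noncomputable def expMinus {n : ℕ} (x : EuclideanSpace ℝ (Fin n)) : SL n :=
  ⟨NormedSpace.exp (gMinusMatrix x), det_exp_gMinusMatrix x⟩

section Geometry

variable {n : ℕ} {M : Type*} [TopologicalSpace M] [ChartedSpace (EuclideanSpace ℝ (Fin n)) M]
  {E : Type*} [NormedAddCommGroup E] [NormedSpace ℝ E]
  {𝒢 : Type*} [TopologicalSpace 𝒢] [ChartedSpace E 𝒢] [IsManifold 𝓘(ℝ, E) ∞ 𝒢]

namespace CartanGeometry

/-- The constant vector field `ω⁻¹(A)` on `𝒢` determined by `A ∈ sl(n+1, ℝ)`. -/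
noncomputable def constantField (C : CartanGeometry n M (E := E) 𝒢) (A : sl n) (u : 𝒢) :
    TangentSpace 𝓘(ℝ, E) u :=
  (C.form u).symm A

/-- `γ` is, on `[0, 1]`, the flow line through `u₀` of the constant vector field of `A`. -/
def IsFlowLine (C : CartanGeometry n M (E := E) 𝒢) (u₀ : 𝒢) (A : sl n) (γ : ℝ → 𝒢) : Prop :=
  γ 0 = u₀ ∧ IsMIntegralCurveOn (I := 𝓘(ℝ, E)) γ (C.constantField A) (Set.Icc 0 1)

/-- The section `t ↦ [γ t, f t]` of the standard tractor bundle `𝒢 ×_P ℝ^{n+1}` along the curve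
`p ∘ γ` is parallel over `[0, 1]` for the tractor connection. -/
def IsParallelAlong (C : CartanGeometry n M (E := E) 𝒢) (γ : ℝ → 𝒢)
    (f : ℝ → Fin (n + 1) → ℝ) : Prop :=
  MDifferentiableOn 𝓘(ℝ, ℝ) 𝓘(ℝ, E) γ (Set.Icc 0 1) ∧
  ∀ t ∈ Set.Icc (0 : ℝ) 1, HasDerivWithinAt f
    (-((C.form (γ t) (mfderivWithin 𝓘(ℝ, ℝ) 𝓘(ℝ, E) γ (Set.Icc 0 1) t (1 : ℝ))).1 *ᵥ f t))
    (Set.Icc 0 1) t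

theorem exists_act (C : CartanGeometry n M (E := E) 𝒢) {u v : 𝒢} (h : C.proj u = C.proj v) :
    ∃ b, C.act u b = v := by
  obtain ⟨U, e, -, hx, hs, -, -, -, he⟩ := C.locally_trivial (C.proj u)
  have hu : u ∈ e.source := by rw [hs]; exact hx
  have hv : v ∈ e.source := by rw [hs]; change C.proj v ∈ U; rwa [← h]
  refine ⟨(e u).2⁻¹ * (e v).2, ?_⟩
  have hub : C.act u ((e u).2⁻¹ * (e v).2) ∈ e.source := by
    rw [hs]; change C.proj _ ∈ U; rwa [C.proj_act]
  refine e.injOn hub hv (Prod.ext ?_ ?_)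
  · rw [(he _ hub).1, (he _ hv).1, C.proj_act, h]
  · rw [(he u hu).2, mul_inv_cancel_left]

theorem act_injective (C : CartanGeometry n M (E := E) 𝒢) {u : 𝒢} {a b : P n}
    (h : C.act u a = C.act u b) : a = b := by
  obtain ⟨U, e, -, hx, hs, -, -, -, he⟩ := C.locally_trivial (C.proj u)
  have hu : u ∈ e.source := by rw [hs]; exact hx
  have := congrArg (fun v => (e v).2) h
  simpa only [(he u hu).2, mul_right_inj] using this

/-- The part `p⁻¹(U)` of the Cartan bundle over an open set `U`. -/
def restr (C : CartanGeometry n M (E := E) 𝒢) (U : TopologicalSpace.Opens M) :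
    TopologicalSpace.Opens 𝒢 :=
  ⟨C.proj ⁻¹' U, U.isOpen.preimage C.proj_smooth.continuous⟩

/-- The principal right action of `P` on `p⁻¹(U)`. -/
def actOver (C : CartanGeometry n M (E := E) 𝒢) {U : TopologicalSpace.Opens M} (u : C.restr U)
    (b : P n) : C.restr U :=
  ⟨C.act u b, by change C.proj _ ∈ U; rw [C.proj_act]; exact u.2⟩

/-- The base point in `U` of a point of `p⁻¹(U)`. -/
def projOver (C : CartanGeometry n M (E := E) 𝒢) {U : TopologicalSpace.Opens M} (u : C.restr U) :
    U :=
  ⟨C.proj u, u.2⟩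

/-- Local sections over `U` of the associated bundle `𝒢 ×_P W`, as `P`-equivariant functions
`p⁻¹(U) → W`. -/
@[ext] structure LocalSection (C : CartanGeometry n M (E := E) 𝒢) {W : Type*} [AddCommGroup W]
    [Module ℝ W] (ρ : Representation ℝ (P n) W) (U : TopologicalSpace.Opens M) where
  toFun : C.restr U → W
  equivariant : ∀ u b, toFun (C.actOver u b) = ρ b⁻¹ (toFun u)

/-- Smoothness of a local section. -/
def LocalSection.IsSmooth {C : CartanGeometry n M (E := E) 𝒢} {W : Type*} [NormedAddCommGroup W]
    [NormedSpace ℝ W] {ρ : Representation ℝ (P n) W} {U : TopologicalSpace.Opens M}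
    (s : C.LocalSection ρ U) : Prop :=
  ContMDiff 𝓘(ℝ, E) 𝓘(ℝ, W) ∞ s.toFun

/-- The product `f s` of a section with a function on the base. -/
def LocalSection.mulFun {C : CartanGeometry n M (E := E) 𝒢} {W : Type*} [AddCommGroup W]
    [Module ℝ W] {ρ : Representation ℝ (P n) W} {U : TopologicalSpace.Opens M}
    (f : U → ℝ) (s : C.LocalSection ρ U) : C.LocalSection ρ U where
  toFun u := f (C.projOver u) • s.toFun u
  equivariant u b := by
    have : C.projOver (C.actOver u b) = C.projOver u := Subtype.ext (C.proj_act u b)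
    rw [this, s.equivariant, map_smul]

end CartanGeometry

/-- The standard representation of `P` on `ℝ^{n+1}`, inducing the standard tractor bundle. -/
noncomputable def stdRep (n : ℕ) : Representation ℝ (P n) (Fin (n + 1) → ℝ) where
  toFun b := Matrix.mulVecLin (mat b)
  map_one' := by rw [mat_one, Matrix.mulVecLin_one]; rfl
  map_mul' a b := by rw [mat_mul, Matrix.mulVecLin_mul]; rfl

/-- The representation of `P` dual to the invariant line `ℝ e₀` (on which `b` acts by its entry
`b₀₀`), in the basis dual to `e₀`. It induces the density bundle `𝓔(1)`, the dual of `𝓔(-1)`. -/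
noncomputable def densityRep (n : ℕ) : Representation ℝ (P n) ℝ where
  toFun b := (mat b 0 0)⁻¹ • LinearMap.id
  map_one' := by rw [mat_one]; simp; rfl
  map_mul' a b := by
    have : mat (a * b) 0 0 = mat a 0 0 * mat b 0 0 := by
      rw [mat_mul, Matrix.mul_apply, Fin.sum_univ_succ]
      simp [mat_succ_zero]
    ext
    simp [this]

/-- A normal chart determined by `u₀`: a smooth map `Φ : V → 𝒢`, `Φ(X) = Fl₁^{X̃}(u₀)`, on an open
neighbourhood `V` of zero in `𝔤₋₁ = ℝⁿ`, for which `p ∘ Φ` is a diffeomorphism from `V` onto an open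
subset `U` of `M`. The inverse of this diffeomorphism is `chart`, so `U` is its source and `V` is
its target. -/
structure NormalChart (C : CartanGeometry n M (E := E) 𝒢) (u₀ : 𝒢) where
  chart : OpenPartialHomeomorph M (EuclideanSpace ℝ (Fin n))
  chart_smooth : ContMDiffOn (𝓡 n) (𝓡 n) ∞ chart chart.source
  chart_symm_smooth : ContMDiffOn (𝓡 n) (𝓡 n) ∞ chart.symm chart.target
  zero_mem : (0 : EuclideanSpace ℝ (Fin n)) ∈ chart.target
  Phi : EuclideanSpace ℝ (Fin n) → 𝒢
  Phi_smooth : ContMDiffOn (𝓡 n) 𝓘(ℝ, E) ∞ Phi chart.target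
  Phi_flow : ∀ X ∈ chart.target, ∃ γ : ℝ → 𝒢, C.IsFlowLine u₀ (gMinus X) γ ∧ Phi X = γ 1
  proj_Phi : ∀ X ∈ chart.target, C.proj (Phi X) = chart.symm X

namespace NormalChart

variable {C : CartanGeometry n M (E := E) 𝒢} {u₀ : 𝒢}

/-- The domain `U ⊂ M` of the normal chart. -/
def domain (N : NormalChart C u₀) : TopologicalSpace.Opens M := ⟨N.chart.source, N.chart.open_source⟩

/-- The normal coordinates `x₁, …, xₙ` on `U`. -/
def coord (N : NormalChart C u₀) (i : Fin n) (x : N.domain) : ℝ := N.chart x i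

/-- The normal section `σ : U → p⁻¹(U)`. -/
def sect (N : NormalChart C u₀) (x : N.domain) : C.restr N.domain :=
  ⟨N.Phi (N.chart x), by
    change C.proj _ ∈ N.chart.source
    rw [N.proj_Phi _ (N.chart.map_source x.2)]
    exact N.chart.map_target (N.chart.map_source x.2)⟩

theorem proj_sect (N : NormalChart C u₀) (x : N.domain) : C.proj (N.sect x) = x := by
  change C.proj (N.Phi _) = x
  rw [N.proj_Phi _ (N.chart.map_source x.2), N.chart.left_inv x.2]

theorem exists_gauge (N : NormalChart C u₀) (u : C.restr N.domain) :
    ∃ b, C.act (N.sect (C.projOver u)) b = u :=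
  C.exists_act (N.proj_sect (C.projOver u))

/-- The unique `b ∈ P` with `u = σ(p(u)) · b`. -/
noncomputable def gauge (N : NormalChart C u₀) (u : C.restr N.domain) : P n :=
  (N.exists_gauge u).choose

theorem gauge_spec (N : NormalChart C u₀) (u : C.restr N.domain) :
    C.act (N.sect (C.projOver u)) (N.gauge u) = u :=
  (N.exists_gauge u).choose_spec

theorem gauge_act (N : NormalChart C u₀) (u : C.restr N.domain) (b : P n) :
    N.gauge (C.actOver u b) = N.gauge u * b := by
  have h1 : C.projOver (C.actOver u b) = C.projOver u := Subtype.ext (C.proj_act u b)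
  have h2 := N.gauge_spec (C.actOver u b)
  rw [h1] at h2
  refine C.act_injective (h2.trans ?_)
  rw [C.act_mul, N.gauge_spec]
  rfl

/-- The section of `𝒢 ×_P W` over `U` which corresponds to the constant `w ∈ W` in the normal
trivialisation. For `w` in a basis of `W`, these sections form the normal frame. -/
noncomputable def normalSection (N : NormalChart C u₀) {W : Type*} [AddCommGroup W] [Module ℝ W]
    (ρ : Representation ℝ (P n) W) (w : W) : C.LocalSection ρ N.domain where
  toFun u := ρ (N.gauge u)⁻¹ w
  equivariant u b := by
    rw [N.gauge_act, mul_inv_rev, map_mul]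
    rfl

/-- The densities `X⁰` (the normal frame of `𝓔(1)` dual to the normal frame of `𝓔(-1)` given by
`e₀`) and `Xⁱ = xᵢ X⁰`. -/
noncomputable def X (N : NormalChart C u₀) : Fin (n + 1) → C.LocalSection (densityRep n) N.domain :=
  Fin.cons (N.normalSection (densityRep n) 1)
    fun i => (N.normalSection (densityRep n) 1).mulFun (N.coord i)

/-! ### Generalised homogeneous coordinates

The homogeneous model is `G → G/P`, `G = SL(n+1, ℝ)`; via `g ↦ ℝ₊ g e₀`, the space `G/P` is the
sphere of rays in `ℝ^{n+1}`. The normal section of the model determined by `1 ∈ G` is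
`exp(X)P ↦ exp(X)`, `X ∈ 𝔤₋₁`. -/

/-- The normal comparison map `ψ : U → G/P`. -/
noncomputable def comparison (N : NormalChart C u₀) (x : N.domain) : SL n ⧸ P n :=
  (expMinus (N.chart x) : SL n)

/-- The bundle map `p⁻¹(U) → G` over the comparison map which intertwines the normal sections, i.e.
`σ(x) · b ↦ exp(X) b` where `X` is the value at `x` of the normal chart. -/
noncomputable def comparisonLift (N : NormalChart C u₀) (u : C.restr N.domain) : SL n :=
  expMinus (N.chart (C.projOver u)) * N.gauge u

/-- The `P`-equivariant function on `G` which corresponds to the `i`-th standard coordinate on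
`ℝ^{n+1} ∖ {0}`, a function homogeneous of degree one and thus a section of `𝓔(1)` over `G/P`. -/
def modelCoord {n : ℕ} (i : Fin (n + 1)) (g : SL n) : ℝ := (g.1 *ᵥ e0 n) i

/-- The generalised homogeneous coordinates determined by a normal chart: the pullbacks along the
normal comparison map of the densities on the homogeneous model given by the standard coordinates
on `ℝ^{n+1} ∖ {0}`. -/
noncomputable def genHomCoord (N : NormalChart C u₀) (i : Fin (n + 1)) :
    C.LocalSection (densityRep n) N.domain where
  toFun u := modelCoord i (N.comparisonLift u)
  equivariant u b := by
    have h1 : C.projOver (C.actOver u b) = C.projOver u := Subtype.ext (C.proj_act u b)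
    have h2 : (mat b⁻¹ 0 0)⁻¹ = mat b 0 0 := by
      have h := congrFun (congrFun (mat_mul b⁻¹ b) 0) 0
      rw [inv_mul_cancel, mat_one, Matrix.mul_apply, Fin.sum_univ_succ] at h
      simp only [Matrix.one_apply_eq, mat_succ_zero, mul_zero, Finset.sum_const_zero, add_zero] at h
      exact inv_eq_of_mul_eq_one_right h.symm
    have h3 : ∀ a : SL n, (a * (b : SL n)).1 *ᵥ e0 n = mat b 0 0 • (a.1 *ᵥ e0 n) := fun a => by
      rw [Matrix.SpecialLinearGroup.coe_mul, ← Matrix.mulVec_mulVec]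
      change a.1 *ᵥ (mat b *ᵥ e0 n) = _
      rw [mat_mulVec_e0, Matrix.mulVec_smul]
    change modelCoord i _ = (mat b⁻¹ 0 0)⁻¹ • modelCoord i _
    rw [h2]
    simp only [modelCoord, comparisonLift, h1, gauge_act, Subgroup.coe_mul, ← mul_assoc, h3,
      Pi.smul_apply]

/-- The local frame of the standard tractor bundle over `U` obtained from the frame `[u₀, eᵢ]` at
`p(u₀)` by parallel transport, for the tractor connection, along the projections to `M` of the flow
lines through `u₀` of the constant vector fields with generator in `𝔤₋₁`. -/
def IsRadiallyParallelFrame (N : NormalChart C u₀)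
    (t : Fin (n + 1) → C.LocalSection (stdRep n) N.domain) : Prop :=
  ∀ (i : Fin (n + 1)) (x : N.domain), ∃ (γ : ℝ → 𝒢) (f : ℝ → Fin (n + 1) → ℝ),
    C.IsFlowLine u₀ (gMinus (N.chart x)) γ ∧ γ 1 = N.sect x ∧
    f 0 = Pi.single i 1 ∧ C.IsParallelAlong γ f ∧ (t i).toFun (N.sect x) = f 1

end NormalChart

end Geometry

end ProjTractor

/-! Write `u = σ(y) · b` with `b = N.gauge u` and `y = φ(x)`, and let `A = gMinusMatrix x`. An
equivariant function is determined by its values along `σ`, so every claim becomes linear algebra in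
`b` and `A`. Since `A * A = 0`, `exp A = 1 + A` and `exp (-A) = 1 - A`.

Coordinates: `exp A` sends `e₀` to `(1, x)` and `b` scales `e₀` by `b₀₀`, so `(X⁰, …, Xⁿ)(u) = b₀₀
exp(A) e₀ = Ψ(u) e₀` (`X_eq_smul`, `X_eq_comparisonLift`). This gives the equality with the
generalised homogeneous coordinates and the statement about rays.

Tractors: along the flow line of `ω⁻¹(x)` the form `ω` takes the constant value `A` on the velocity,
so parallel transport is the equation `f' = -A f` and `tᵢ` equals `exp(-A) eᵢ` at `σ(y)`
(`eq_of_hasDerivWithinAt_neg_mulVec`). Hence `∑ Xⁱ tᵢ` at `u` is `b⁻¹ exp(-A) b₀₀ exp(A) e₀ = e₀`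
(`sum_X_smul_parallelFrame`), and invertibility of `b⁻¹ exp(-A)` makes the components unique. The
constant `e₀` represents the canonical section because the factors `b₀₀` of `𝓔(1)` and `𝓔(-1)`
cancel. -/

namespace ProjTractor

/-! ### Algebra of `P` and of the exponential on `𝔤₋₁` -/

section Group

variable {n : ℕ}

theorem mat_mul_zero_zero (a b : P n) : mat (a * b) 0 0 = mat a 0 0 * mat b 0 0 := by
  rw [mat_mul, Matrix.mul_apply, Fin.sum_univ_succ]
  simp [mat_succ_zero]

theorem mat_inv_zero_zero (b : P n) : mat b⁻¹ 0 0 = (mat b 0 0)⁻¹ := by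
  refine eq_inv_of_mul_eq_one_left ?_
  rw [← mat_mul_zero_zero, inv_mul_cancel, mat_one, Matrix.one_apply_eq]

theorem densityRep_inv_apply (b : P n) (c : ℝ) : densityRep n b⁻¹ c = mat b 0 0 * c := by
  change (mat b⁻¹ 0 0)⁻¹ • c = _
  rw [mat_inv_zero_zero, inv_inv, smul_eq_mul]

theorem stdRep_apply (b : P n) (v : Fin (n + 1) → ℝ) : stdRep n b v = mat b *ᵥ v := rfl

theorem stdRep_inv_e0 (b : P n) : stdRep n b⁻¹ (e0 n) = (mat b 0 0)⁻¹ • e0 n := by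
  rw [stdRep_apply, mat_mulVec_e0, mat_inv_zero_zero]

theorem SL.mul_mulVec_e0 (a : SL n) (b : P n) :
    (a * (b : SL n)).1 *ᵥ e0 n = mat b 0 0 • (a.1 *ᵥ e0 n) := by
  rw [Matrix.SpecialLinearGroup.coe_mul, ← Matrix.mulVec_mulVec]
  change a.1 *ᵥ (mat b *ᵥ e0 n) = _
  rw [mat_mulVec_e0, Matrix.mulVec_smul]

theorem expMinus_mulVec_e0 (x : EuclideanSpace ℝ (Fin n)) :
    (expMinus x).1 *ᵥ e0 n = Fin.cons 1 x := by
  change NormedSpace.exp (gMinusMatrix x) *ᵥ _ = _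
  rw [exp_gMinusMatrix, e0, Matrix.mulVec_single_one]
  ext i
  refine Fin.cases ?_ (fun i => ?_) i <;> simp [gMinusMatrix, Matrix.col_apply]

theorem one_sub_mul_one_add_gMinusMatrix (x : EuclideanSpace ℝ (Fin n)) :
    (1 - gMinusMatrix x) * (1 + gMinusMatrix x) = 1 := by
  simp [sub_mul, mul_add, gMinusMatrix_sq]

/-- In the global chart `(Z, B)` of `P` this entry is `1 / det B`, the inverse of a positive
polynomial function. -/
theorem contMDiff_mat_zero_zero :
    ContMDiff 𝓘(ℝ, PModel n) 𝓘(ℝ, ℝ) ∞ fun b : P n => mat b 0 0 := by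
  have h : (fun b : P n => mat b 0 0) = fun b => (Matrix.of (pChart b).2).det⁻¹ := by
    funext b
    conv_lhs => rw [mat_eq]
    rfl
  rw [h]
  refine ContMDiff.inv₀ ?_ fun b => (det_pChart_pos b).ne'
  have hdet : ContDiff ℝ ∞ fun q : PModel n => (Matrix.of q.2).det := by
    simp only [Matrix.det_apply, Matrix.of_apply]
    fun_prop
  exact hdet.contMDiff.comp
    (contMDiff_isOpenEmbedding (I := 𝓘(ℝ, PModel n)) (isOpenEmbedding_pChart n))

end Group

section Geometry

variable {n : ℕ} {M : Type*} [TopologicalSpace M] [ChartedSpace (EuclideanSpace ℝ (Fin n)) M]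
  {E : Type*} [NormedAddCommGroup E] [NormedSpace ℝ E]
  {𝒢 : Type*} [TopologicalSpace 𝒢] [ChartedSpace E 𝒢] [IsManifold 𝓘(ℝ, E) ∞ 𝒢]

/-! ### Parallel transport along flow lines as a linear differential equation -/

namespace CartanGeometry

variable {C : CartanGeometry n M (E := E) 𝒢} {u₀ : 𝒢} {A : sl n} {γ : ℝ → 𝒢}

theorem IsFlowLine.form_mfderivWithin (h : C.IsFlowLine u₀ A γ) {t : ℝ}
    (ht : t ∈ Set.Icc (0 : ℝ) 1) :
    C.form (γ t) (mfderivWithin 𝓘(ℝ, ℝ) 𝓘(ℝ, E) γ (Set.Icc 0 1) t (1 : ℝ)) = A := by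
  have hu : UniqueMDiffWithinAt 𝓘(ℝ, ℝ) (Set.Icc (0 : ℝ) 1) t :=
    (uniqueDiffOn_Icc zero_lt_one).uniqueMDiffOn t ht
  have hd := (h.2 t ht).mfderivWithin hu
  have h1 : mfderivWithin 𝓘(ℝ, ℝ) 𝓘(ℝ, E) γ (Set.Icc 0 1) t (1 : ℝ)
      = C.constantField A (γ t) := by
    rw [hd]
    exact one_smul ℝ _
  rw [h1]
  exact (C.form (γ t)).apply_symm_apply A

/-- The velocity of a flow line is `ω⁻¹(A)`, so the coefficient in the transport equation is
constant and the curve drops out of it. -/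
theorem IsFlowLine.isParallelAlong_iff (h : C.IsFlowLine u₀ A γ) (f : ℝ → Fin (n + 1) → ℝ) :
    C.IsParallelAlong γ f ↔ ∀ t ∈ Set.Icc (0 : ℝ) 1,
      HasDerivWithinAt f (-(A.1 *ᵥ f t)) (Set.Icc 0 1) t := by
  constructor
  · intro hf t ht
    have := hf.2 t ht
    rwa [h.form_mfderivWithin ht] at this
  · refine fun hf => ⟨fun t ht => (h.2 t ht).mdifferentiableWithinAt, fun t ht => ?_⟩
    rw [h.form_mfderivWithin ht]
    exact hf t ht

end CartanGeometry

theorem hasDerivWithinAt_mulVec {m : ℕ} (A : Matrix (Fin m) (Fin m) ℝ) {f : ℝ → Fin m → ℝ}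
    {f' : Fin m → ℝ} {s : Set ℝ} {t : ℝ} (hf : HasDerivWithinAt f f' s t) :
    HasDerivWithinAt (fun t => A *ᵥ f t) (A *ᵥ f') s t :=
  (LinearMap.toContinuousLinearMap A.mulVecLin).hasFDerivAt.comp_hasDerivWithinAt t hf

/-- The quantity `exp(tA) f(t) = f t + t • A f(t)` is conserved: its derivative is `-A f + A f - t •
A² f = 0`. -/
theorem eq_of_hasDerivWithinAt_neg_mulVec {m : ℕ} {A : Matrix (Fin m) (Fin m) ℝ} (hA : A * A = 0)
    {f : ℝ → Fin m → ℝ}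
    (hf : ∀ t ∈ Set.Icc (0 : ℝ) 1, HasDerivWithinAt f (-(A *ᵥ f t)) (Set.Icc 0 1) t) :
    f 1 = (1 - A) *ᵥ f 0 := by
  have hg : ∀ t ∈ Set.Icc (0 : ℝ) 1,
      HasDerivWithinAt (fun t => f t + t • (A *ᵥ f t)) 0 (Set.Icc 0 1) t := by
    intro t ht
    refine ((hf t ht).add
      ((hasDerivWithinAt_id t _).smul (hasDerivWithinAt_mulVec A (hf t ht)))).congr_deriv ?_
    simp [Matrix.mulVec_neg, Matrix.mulVec_mulVec, hA]
  have h1 := constant_of_derivWithin_zero (fun t ht => (hg t ht).differentiableWithinAt)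
    (fun t ht => (hg t (Set.Ico_subset_Icc_self ht)).derivWithin
      (uniqueDiffOn_Icc zero_lt_one t (Set.Ico_subset_Icc_self ht))) 1 (by simp)
  simp only [one_smul, zero_smul, add_zero] at h1
  -- Conservation reads `(1 + A) f(1) = f(0)`; applying `1 - A` inverts it.
  rw [← h1, Matrix.mulVec_add, Matrix.mulVec_mulVec]
  simp [Matrix.sub_mulVec, sub_mul, hA]

theorem hasDerivWithinAt_one_sub_smul_mulVec {m : ℕ} {A : Matrix (Fin m) (Fin m) ℝ}
    (hA : A * A = 0) (v : Fin m → ℝ) (s : Set ℝ) (t : ℝ) :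
    HasDerivWithinAt (fun t : ℝ => v - t • (A *ᵥ v)) (-(A *ᵥ (v - t • (A *ᵥ v)))) s t := by
  refine (((hasDerivWithinAt_id t s).smul_const (A *ᵥ v)).const_sub v).congr_deriv ?_
  simp [Matrix.mulVec_sub, Matrix.mulVec_smul, Matrix.mulVec_mulVec, hA]

/-! ### The normal gauge and the generalised homogeneous coordinates -/

namespace NormalChart

variable {C : CartanGeometry n M (E := E) 𝒢} {u₀ : 𝒢} (N : NormalChart C u₀)

theorem projOver_sect (x : N.domain) : C.projOver (N.sect x) = x :=
  Subtype.ext (N.proj_sect x)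

theorem gauge_sect (x : N.domain) : N.gauge (N.sect x) = 1 := by
  have h := N.gauge_spec (N.sect x)
  rw [N.projOver_sect] at h
  exact C.act_injective (h.trans (C.act_one _).symm)

theorem actOver_sect_gauge (u : C.restr N.domain) :
    C.actOver (N.sect (C.projOver u)) (N.gauge u) = u :=
  Subtype.ext (N.gauge_spec u)

variable {N} in
theorem _root_.ProjTractor.CartanGeometry.LocalSection.apply_eq_gauge {W : Type*} [AddCommGroup W]
    [Module ℝ W] {ρ : Representation ℝ (P n) W} (s : C.LocalSection ρ N.domain)
    (u : C.restr N.domain) :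
    s.toFun u = ρ (N.gauge u)⁻¹ (s.toFun (N.sect (C.projOver u))) := by
  conv_lhs => rw [← N.actOver_sect_gauge u, s.equivariant]

theorem X_zero_apply (u : C.restr N.domain) : (N.X 0).toFun u = mat (N.gauge u) 0 0 := by
  change densityRep n (N.gauge u)⁻¹ 1 = _
  rw [densityRep_inv_apply, mul_one]

theorem X_succ_apply (i : Fin n) (u : C.restr N.domain) :
    (N.X i.succ).toFun u = N.chart (C.projOver u) i * mat (N.gauge u) 0 0 := by
  rw [← N.X_zero_apply]; rfl

theorem X_eq_smul (u : C.restr N.domain) :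
    (fun i => (N.X i).toFun u) =
      mat (N.gauge u) 0 0 • ((expMinus (N.chart (C.projOver u))).1 *ᵥ e0 n) := by
  rw [expMinus_mulVec_e0]
  ext i
  refine Fin.cases ?_ (fun i => ?_) i
  · simp [X_zero_apply]
  · simp [X_succ_apply, mul_comm]

theorem X_eq_comparisonLift (u : C.restr N.domain) :
    (fun i => (N.X i).toFun u) = (N.comparisonLift u).1 *ᵥ e0 n := by
  rw [X_eq_smul, comparisonLift, SL.mul_mulVec_e0]

theorem X_eq_genHomCoord (i : Fin (n + 1)) : N.X i = N.genHomCoord i := by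
  ext u
  exact congrFun (N.X_eq_comparisonLift u) i

theorem exists_X_eq_smul_of_comparison (u : C.restr N.domain) (g : SL n)
    (hg : (g : SL n ⧸ P n) = N.comparison (C.projOver u)) :
    ∃ r : ℝ, 0 < r ∧ (fun i => (N.X i).toFun u) = r • (g.1 *ᵥ e0 n) := by
  have hb : g⁻¹ * expMinus (N.chart (C.projOver u)) ∈ P n := QuotientGroup.eq.1 hg
  -- The second factor compares `exp(x) e₀` with `g e₀`, the first compares the densities at `u`
  -- with `exp(x) e₀`.
  refine ⟨mat (N.gauge u) 0 0 * mat ⟨_, hb⟩ 0 0,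
    mul_pos (mat_zero_zero_pos _) (mat_zero_zero_pos _), ?_⟩
  have h := SL.mul_mulVec_e0 g ⟨_, hb⟩
  rw [mul_inv_cancel_left] at h
  rw [X_eq_smul, mul_smul, h]

/-! ### Smoothness -/

theorem contMDiff_projOver :
    ContMDiff 𝓘(ℝ, E) (𝓡 n) ∞ fun u : C.restr N.domain => C.proj u :=
  C.proj_smooth.comp contMDiff_subtype_val

theorem contMDiff_chart_projOver :
    ContMDiff 𝓘(ℝ, E) (𝓡 n) ∞ fun u : C.restr N.domain => N.chart (C.projOver u) :=
  N.chart_smooth.comp_contMDiff N.contMDiff_projOver fun u => u.2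

theorem contMDiff_sect_projOver :
    ContMDiff 𝓘(ℝ, E) 𝓘(ℝ, E) ∞
      fun u : C.restr N.domain => (N.sect (C.projOver u) : 𝒢) :=
  N.Phi_smooth.comp_contMDiff N.contMDiff_chart_projOver fun u => N.chart.map_source u.2

/-- The gauge is chosen pointwise, but in a local trivialisation it is the quotient of the fibre
coordinates of `σ(p(u))` and `u`. As `b ↦ b₀₀` is multiplicative, its value is a ratio of two smooth
positive functions. -/
theorem contMDiff_gauge_zero_zero :
    ContMDiff 𝓘(ℝ, E) 𝓘(ℝ, ℝ) ∞ fun u : C.restr N.domain => mat (N.gauge u) 0 0 := by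
  intro u
  obtain ⟨W, e, hW, hx, hs, -, he, -, htriv⟩ := C.locally_trivial (C.proj u)
  have hu : (u : 𝒢) ∈ e.source := by rw [hs]; exact hx
  have hsect : ∀ v : C.restr N.domain, C.proj v ∈ W →
      (N.sect (C.projOver v) : 𝒢) ∈ e.source := by
    intro v hv
    rw [hs]
    change C.proj _ ∈ W
    rwa [N.proj_sect]
  have hsm : ∀ {F : C.restr N.domain → 𝒢}, ContMDiff 𝓘(ℝ, E) 𝓘(ℝ, E) ∞ F → F u ∈ e.source →
      ContMDiffAt 𝓘(ℝ, E) 𝓘(ℝ, ℝ) ∞ (fun v => mat (e (F v)).2 0 0) u := by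
    intro F hF hFu
    have h1 := ((he.contMDiffAt (e.open_source.mem_nhds hFu)).snd).comp u hF.contMDiffAt
    exact contMDiff_mat_zero_zero.contMDiffAt.comp u h1
  refine (((hsm N.contMDiff_sect_projOver (hsect u hx)).inv₀ (mat_zero_zero_pos _).ne').mul
    (hsm contMDiff_subtype_val hu)).congr_of_eventuallyEq ?_
  have hnear : ∀ᶠ v : C.restr N.domain in 𝓝 u, C.proj v ∈ W :=
    N.contMDiff_projOver.continuous.continuousAt (hW.mem_nhds hx)
  filter_upwards [hnear] with v hv
  have h := (htriv _ (hsect v hv)).2 (N.gauge v)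
  rw [N.gauge_spec] at h
  change _ = (mat (e (N.sect (C.projOver v))).2 0 0)⁻¹ * mat (e (v : 𝒢)).2 0 0
  rw [h, mat_mul_zero_zero, inv_mul_cancel_left₀ (mat_zero_zero_pos _).ne']

theorem X_isSmooth (i : Fin (n + 1)) : (N.X i).IsSmooth := by
  have h0 : ContMDiff 𝓘(ℝ, E) 𝓘(ℝ, ℝ) ∞ (N.X 0).toFun := by
    rw [funext N.X_zero_apply]
    exact N.contMDiff_gauge_zero_zero
  refine Fin.cases h0 (fun i => ?_) i
  have h : ContMDiff 𝓘(ℝ, E) 𝓘(ℝ, ℝ) ∞ fun u : C.restr N.domain =>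
      N.chart (C.projOver u) i :=
    (EuclideanSpace.proj (𝕜 := ℝ) i).contMDiff.comp N.contMDiff_chart_projOver
  change ContMDiff 𝓘(ℝ, E) 𝓘(ℝ, ℝ) ∞ (N.X i.succ).toFun
  rw [funext (N.X_succ_apply i)]
  exact h.mul N.contMDiff_gauge_zero_zero

/-! ### The radially parallel frame -/

/-- The section of the standard tractor bundle over `U` whose value along the normal section at
`x` is the radial parallel transport `exp(-X) eᵢ`. -/
noncomputable def parallelFrame (i : Fin (n + 1)) : C.LocalSection (stdRep n) N.domain where
  toFun u := stdRep n (N.gauge u)⁻¹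
    ((1 - gMinusMatrix (N.chart (C.projOver u))) *ᵥ Pi.single i 1)
  equivariant u b := by
    have h : C.projOver (C.actOver u b) = C.projOver u := Subtype.ext (C.proj_act u b)
    rw [h, N.gauge_act, mul_inv_rev, map_mul]
    rfl

theorem parallelFrame_sect (i : Fin (n + 1)) (x : N.domain) :
    (N.parallelFrame i).toFun (N.sect x) = (1 - gMinusMatrix (N.chart x)) *ᵥ Pi.single i 1 := by
  change stdRep n (N.gauge (N.sect x))⁻¹
    ((1 - gMinusMatrix (N.chart (C.projOver (N.sect x)))) *ᵥ Pi.single i 1) = _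
  rw [N.gauge_sect, N.projOver_sect, inv_one, map_one]
  rfl

theorem isRadiallyParallelFrame_parallelFrame : N.IsRadiallyParallelFrame N.parallelFrame := by
  intro i x
  obtain ⟨γ, hγ, h1⟩ := N.Phi_flow (N.chart x) (N.chart.map_source x.2)
  refine ⟨γ, fun t => Pi.single i 1 - t • (gMinusMatrix (N.chart x) *ᵥ Pi.single i 1), hγ,
    h1.symm, by simp, (hγ.isParallelAlong_iff _).2 fun t _ =>
      hasDerivWithinAt_one_sub_smul_mulVec (gMinusMatrix_sq _) _ _ t, ?_⟩
  rw [parallelFrame_sect, Matrix.sub_mulVec, Matrix.one_mulVec]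
  exact (congrArg _ (one_smul ℝ _)).symm

variable {N} in
-- Each value may come with its own flow line, but the endpoint of the transport depends only on `A`
-- and `f 0`, so uniqueness of flow lines is not needed.
theorem IsRadiallyParallelFrame.eq_parallelFrame
    {t : Fin (n + 1) → C.LocalSection (stdRep n) N.domain} (ht : N.IsRadiallyParallelFrame t) :
    t = N.parallelFrame := by
  have hsect : ∀ i x, (t i).toFun (N.sect x) = (N.parallelFrame i).toFun (N.sect x) := by
    intro i x
    obtain ⟨γ, f, hγ, -, hf0, hf, h⟩ := ht i x
    rw [h, parallelFrame_sect,
      eq_of_hasDerivWithinAt_neg_mulVec (gMinusMatrix_sq _) ((hγ.isParallelAlong_iff f).1 hf), hf0]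
  funext i
  refine CartanGeometry.LocalSection.ext (funext fun u => ?_)
  rw [(t i).apply_eq_gauge, hsect, ← (N.parallelFrame i).apply_eq_gauge]

/-- By linearity the frame at `u` consists of the columns of the matrix `b⁻¹ exp(-A)`; independence
and the component formula both follow from this. -/
theorem sum_smul_parallelFrame (c : Fin (n + 1) → ℝ) (u : C.restr N.domain) :
    ∑ i, c i • (N.parallelFrame i).toFun u =
      stdRep n (N.gauge u)⁻¹ ((1 - gMinusMatrix (N.chart (C.projOver u))) *ᵥ c) := by
  conv_rhs => rw [pi_eq_sum_univ' c, ← Matrix.mulVecLin_apply, map_sum, map_sum]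
  refine Finset.sum_congr rfl fun i _ => ?_
  rw [map_smul, map_smul]
  congr 3

theorem linearIndependent_parallelFrame (u : C.restr N.domain) :
    LinearIndependent ℝ fun i => (N.parallelFrame i).toFun u := by
  rw [Fintype.linearIndependent_iff]
  intro c hc
  rw [sum_smul_parallelFrame] at hc
  -- The two factors are undone in turn: the gauge here, then `1 - A` by its inverse `1 + A`.
  have h1 := congrArg (stdRep n (N.gauge u)) hc
  rw [map_zero, ← Module.End.mul_apply, ← map_mul, mul_inv_cancel, map_one,
    Module.End.one_apply] at h1
  have h2 : (1 + gMinusMatrix (N.chart (C.projOver u))) *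
      (1 - gMinusMatrix (N.chart (C.projOver u))) = 1 :=
    mul_eq_one_comm.1 (one_sub_mul_one_add_gMinusMatrix _)
  have h3 := congrArg ((1 + gMinusMatrix (N.chart (C.projOver u))) *ᵥ ·) h1
  simp only [Matrix.mulVec_mulVec, h2, Matrix.one_mulVec, Matrix.mulVec_zero] at h3
  exact congrFun h3

theorem sum_X_smul_parallelFrame (u : C.restr N.domain) :
    ∑ i, (N.X i).toFun u • (N.parallelFrame i).toFun u = e0 n := by
  rw [N.sum_smul_parallelFrame (fun i => (N.X i).toFun u), X_eq_smul]
  change stdRep n _ (_ *ᵥ (_ • (NormedSpace.exp (gMinusMatrix _) *ᵥ _))) = _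
  rw [exp_gMinusMatrix, Matrix.mulVec_smul, Matrix.mulVec_mulVec,
    one_sub_mul_one_add_gMinusMatrix, Matrix.one_mulVec, map_smul, stdRep_inv_e0, smul_smul,
    mul_inv_cancel₀ (mat_zero_zero_pos _).ne', one_smul]

theorem sum_smul_parallelFrame_eq_e0_iff
    (Y : Fin (n + 1) → C.LocalSection (densityRep n) N.domain) :
    (∀ u, ∑ i, (Y i).toFun u • (N.parallelFrame i).toFun u = e0 n) ↔ Y = N.X := by
  refine ⟨fun h => ?_, fun h => h ▸ N.sum_X_smul_parallelFrame⟩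
  funext i
  refine CartanGeometry.LocalSection.ext (funext fun u => ?_)
  -- Both tuples expand the same vector `e₀` in one frame, so independence at `u` equates the
  -- coefficients.
  have hs := (h u).trans (N.sum_X_smul_parallelFrame u).symm
  rw [← sub_eq_zero, ← Finset.sum_sub_distrib] at hs
  simp only [← sub_smul] at hs
  exact sub_eq_zero.1 (Fintype.linearIndependent_iff.1 (N.linearIndependent_parallelFrame u) _ hs i)

end NormalChart

end Geometry

end ProjTractor

open ProjTractor in
theorem mainTheorem10 {n : ℕ}
    {M : Type*} [TopologicalSpace M] [T2Space M] [ChartedSpace (EuclideanSpace ℝ (Fin n)) M]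
    [IsManifold (𝓡 n) ∞ M]
    {E : Type*} [NormedAddCommGroup E] [NormedSpace ℝ E] [FiniteDimensional ℝ E]
    {𝒢 : Type*} [TopologicalSpace 𝒢] [T2Space 𝒢] [ChartedSpace E 𝒢] [IsManifold 𝓘(ℝ, E) ∞ 𝒢]
    (C : CartanGeometry n M (E := E) 𝒢) (u₀ : 𝒢) (N : NormalChart C u₀) :
    -- the densities are smooth, and they are the generalised homogeneous coordinates
    (∀ i, (N.X i).IsSmooth ∧ N.X i = N.genHomCoord i) ∧
    -- they are homogeneous coordinates of the comparison map to the sphere of rays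
    (∀ (u : C.restr N.domain) (g : SL n), (g : SL n ⧸ P n) = N.comparison (C.projOver u) →
      ∃ r : ℝ, 0 < r ∧ (fun i => (N.X i).toFun u) = r • (g.1 *ᵥ e0 n)) ∧
    -- there is exactly one radially parallel tractor frame, and the densities are the components in
    -- it of the canonical section, i.e. of the constant function with value the first basis vector,
    -- of the tensor product of the standard tractor bundle with the bundle of densities of weight 1
    (∃! t : Fin (n + 1) → C.LocalSection (stdRep n) N.domain, N.IsRadiallyParallelFrame t) ∧
    (∀ t : Fin (n + 1) → C.LocalSection (stdRep n) N.domain, N.IsRadiallyParallelFrame t →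
      (∀ u, LinearIndependent ℝ fun i => (t i).toFun u) ∧
      ∀ Y : Fin (n + 1) → C.LocalSection (densityRep n) N.domain,
        (∀ u, ∑ i, (Y i).toFun u • (t i).toFun u = e0 n) ↔ Y = N.X) := by
  refine ⟨fun i => ⟨N.X_isSmooth i, N.X_eq_genHomCoord i⟩, N.exists_X_eq_smul_of_comparison,
    ⟨N.parallelFrame, N.isRadiallyParallelFrame_parallelFrame, fun t ht => ht.eq_parallelFrame⟩,
    fun t ht => ?_⟩
  rw [ht.eq_parallelFrame]
  exact ⟨N.linearIndependent_parallelFrame, N.sum_smul_parallelFrame_eq_e0_iff⟩
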